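/- **Definitions.** Let $G$ be a permutation group on a set $\Omega$ and let $K$ be a field of characteristic $0$. For $n\ge 0$ let $V_n(G)$ be the $K$-vector space of all $G$-invariant functions from the $n$-element subsets of $\Omega$ to $K$. Cameron's algebra is the commutative graded $K$-algebra $A(G)=\bigoplus_{n\ge 0}V_n(G)$, where the product of $f\in V_m(G)$ and $g\in V_n(G)$ is the element of $V_{m+n}(G)$ given, for every $(m+n)$-subset $X\subseteq\Omega$, by $$(fg)(X)=\sum_{Y\subseteq X,\ |Y|=m} f(Y)\,g(X\setminus Y).$$ $G$ is *oligomorphic* if for each $n$ it has only finitely many orbits on $n$-subsets of $\Omega$. A *set of connected blocks* is a set $T$, each of whose elements $\Delta$ has a positive integral weight $\mathrm{wt}(\Delta)$, together with a well-ordering of $T$ in which blocks of smaller weight precede blocks of larger weight. The weight of a finite sequence of blocks is the sum of the weights of its terms, and $T^*$ denotes the set of finite sequences (words) over $T$, including the empty one. $G$ is *wreath-$A$-like* if there are a set $T$ of connected blocks and a bijection $\phi$ from the set of orbits of $G$ on finite subsets of $\Omega$ to $T^*$ such that, writing $\phi(Y)$ for the value of $\phi$ at the orbit of $Y$: 1.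 $\mathrm{wt}(\phi(Y))=|Y|$ for every finite $Y\subset\Omega$; 2. if $Y\subset\Omega$ is finite and $\phi(Y)=(\Delta_1,\dots,\Delta_k)$, then $Y$ can be partitioned as $Y=Y_1\cup\dots\cup Y_k$ with $|Y_l|=\mathrm{wt}(\Delta_l)$ for each $l$, in such a way that whenever $Z=Z_1\cup\dots\cup Z_k$ with $Z_l\subseteq Y_l$ for each $l$, the sequence $\phi(Z)$ is a concatenation $S_1\oplus\dots\oplus S_k$ of sequences of blocks with $\mathrm{wt}(S_l)=|Z_l|$ for each $l$, and $S_l=(\Delta_l)$ if $Z_l=Y_l$. A word $w\in T^*$ is a *Lyndon word* if it is non-empty and $w<_{\mathrm{lex}}v$ for every factorisation $w=uv$ into non-empty words $u,v$, where $<_{\mathrm{lex}}$ is the lexicographic order (a proper prefix of a word being smaller than the word). **Theorem.** Let $G$ be an oligomorphic wreath-$A$-like permutation group on $\Omega$, with connected blocks $T$ and bijection $\phi$ as above. For $w\in T^*$ let $\chi_w\in A(G)$ be the characteristic function of the orbit $\phi^{-1}(w)$, an element of $V_{\mathrm{wt}(w)}(G)$. Then $A(G)$ is a polynomial ring over $K$,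 freely generated by the $\chi_w$ with $w\in T^*$ a Lyndon word. That is, there is an isomorphism of $K$-algebras from the polynomial ring $K[x_w : w\in T^*\text{ a Lyndon word}]$ onto $A(G)$ that sends $x_w$ to $\chi_w$ for every Lyndon word $w$. -/

import Mathlib

open scoped Pointwise DirectSum

namespace PermAlg

universe u v w x

/-! ### Orbits on finite subsets -/

section Orbits

variable (G : Type u) [Group G] (Ω : Type v) [DecidableEq Ω] [MulAction G Ω]

/-- The set of orbits of `G` on the finite subsets of `Ω`. -/
abbrev SetOrbit : Type v := MulAction.orbitRel.Quotient G (Finset Ω)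

variable {Ω} in
/-- The orbit of a finite subset. -/
def orbitOf (Y : Finset Ω) : SetOrbit G Ω := Quotient.mk _ Y

variable {G Ω}

theorem orbitOf_smul (g : G) (Y : Finset Ω) : orbitOf G (g • Y) = orbitOf G Y :=
  Quotient.sound ⟨g, rfl⟩

theorem orbitOf_eq_iff {Y Z : Finset Ω} : orbitOf G Y = orbitOf G Z ↔ ∃ g : G, g • Z = Y := by
  unfold orbitOf
  rw [Quotient.eq]
  exact MulAction.orbitRel_apply.trans MulAction.mem_orbit_iff

/-- The common cardinality of the members of an orbit on finite subsets. -/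
def SetOrbit.size : SetOrbit G Ω → ℕ :=
  Quotient.lift Finset.card (by
    rintro a b ⟨g, rfl⟩
    exact Finset.card_smul_finset g b)

theorem size_orbitOf (Y : Finset Ω) : (orbitOf G Y).size = Y.card := rfl

variable (G Ω)

/-- `G` is oligomorphic on `Ω`: for each `n` there are only finitely many orbits on `n`-subsets. -/
def IsOligomorphic : Prop :=
  ∀ n : ℕ, Finite (MulAction.orbitRel.Quotient G (Set.powersetCard Ω n))

end Orbits

/-! ### Cameron's graded algebra `A(G)` -/

section Algebra

variable (K : Type x) [Field K] (G : Type u) [Group G] (Ω : Type v) [DecidableEq Ω] [MulAction G Ω]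

/-- `V_n(G)`: the `K`-valued functions on `n`-subsets of `Ω` that are invariant under `G`. -/
def V (n : ℕ) : Submodule K (Set.powersetCard Ω n → K) where
  carrier := {f | ∀ (g : G) (X : Set.powersetCard Ω n), f (g • X) = f X}
  add_mem' := fun ha hb g X => by simp [ha g X, hb g X]
  zero_mem' := fun _ _ => rfl
  smul_mem' := fun c _ hf g X => by simp [hf g X]

variable {K G Ω}

/-- Extension by zero of a function on `n`-subsets to all finite subsets. -/
def ext0 {n : ℕ} (f : V K G Ω n) (X : Finset Ω) : K :=
  if h : X.card = n then f.1 ⟨X, h⟩ else 0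

theorem ext0_of_card {n : ℕ} (f : V K G Ω n) {X : Finset Ω} (h : X.card = n) :
    ext0 f X = f.1 ⟨X, h⟩ := dif_pos h

theorem ext0_of_card_ne {n : ℕ} (f : V K G Ω n) {X : Finset Ω} (h : X.card ≠ n) :
    ext0 f X = 0 := dif_neg h

theorem ext0_coe {n : ℕ} (f : V K G Ω n) (X : Set.powersetCard Ω n) : ext0 f X.1 = f.1 X :=
  dif_pos X.2

theorem ext0_smul {n : ℕ} (f : V K G Ω n) (g : G) (X : Finset Ω) :
    ext0 f (g • X) = ext0 f X := by
  by_cases h : X.card = n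
  · rw [ext0_of_card f h, ext0_of_card f ((Finset.card_smul_finset g X).trans h)]
    exact f.2 g ⟨X, h⟩
  · rw [ext0_of_card_ne f h, ext0_of_card_ne f (by rwa [Finset.card_smul_finset])]

theorem V_ext {n : ℕ} {f g : V K G Ω n} (h : ∀ X, ext0 f X = ext0 g X) : f = g := by
  apply Subtype.ext
  funext X
  rw [← ext0_coe f, ← ext0_coe g, h]

theorem gradedMk_eq {m n : ℕ} (hmn : m = n) {f : V K G Ω m} {g : V K G Ω n}
    (h : ∀ X, ext0 f X = ext0 g X) :
    GradedMonoid.mk (A := fun n => V K G Ω n) m f = GradedMonoid.mk n g := by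
  subst hmn
  rw [V_ext h]

/-- The product of `f ∈ V_m(G)` and `g ∈ V_n(G)` is the element of `V_{m+n}(G)` with
`(fg)(X) = ∑ f(Y) g(X \ Y)`, the sum being over all `m`-subsets `Y` of the `(m+n)`-set `X`. -/
def vmul {m n : ℕ} (f : V K G Ω m) (g : V K G Ω n) : V K G Ω (m + n) where
  val X := ∑ Y ∈ (X.1.powersetCard m).attach,
    f.1 ⟨Y.1, (Finset.mem_powersetCard.1 Y.2).2⟩ *
      g.1 ⟨X.1 \ Y.1, by
        have hY := Finset.mem_powersetCard.1 Y.2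
        have hX : X.1.card = m + n := X.2
        change (X.1 \ Y.1).card = n
        rw [Finset.card_sdiff_of_subset hY.1]
        omega⟩
  property := by
    intro a X
    symm
    refine Finset.sum_bij (fun Y _ => ⟨a • Y.1, ?_⟩) ?_ ?_ ?_ ?_
    · have hY := Finset.mem_powersetCard.1 Y.2
      rw [Finset.mem_powersetCard]
      exact ⟨Finset.smul_finset_subset_smul_finset hY.1,
        (Finset.card_smul_finset a Y.1).trans hY.2⟩
    · intro Y _
      exact Finset.mem_attach _ _
    · intro Y _ Z _ h
      exact Subtype.ext (smul_left_cancel a (congrArg Subtype.val h))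
    · rintro ⟨Z, hZ⟩ _
      rw [Finset.mem_powersetCard] at hZ
      refine ⟨⟨a⁻¹ • Z, ?_⟩, Finset.mem_attach _ _, ?_⟩
      · rw [Finset.mem_powersetCard]
        refine ⟨?_, (Finset.card_smul_finset _ Z).trans hZ.2⟩
        rw [← Finset.subset_smul_finset_iff]
        exact hZ.1
      · exact Subtype.ext (smul_inv_smul a Z)
    · intro Y _
      congr 1
      · exact (f.2 a _).symm
      · rw [← g.2 a]
        exact congrArg g.1 (Subtype.ext Finset.smul_finset_sdiff)

theorem ext0_mul {m n : ℕ} (f : V K G Ω m) (g : V K G Ω n) (X : Finset Ω) :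
    ext0 (vmul f g) X = ∑ Y ∈ X.powerset, ext0 f Y * ext0 g (X \ Y) := by
  by_cases h : X.card = m + n
  · have hcard : ∀ Y : Finset Ω, Y ⊆ X → Y.card = m → (X \ Y).card = n := by
      intro Y hY hm
      rw [Finset.card_sdiff_of_subset hY]
      omega
    rw [ext0_of_card _ h]
    have hsub : X.powersetCard m ⊆ X.powerset := fun Y hY =>
      Finset.mem_powerset.2 (Finset.mem_powersetCard.1 hY).1
    rw [← Finset.sum_subset hsub, ← Finset.sum_attach]
    · apply Finset.sum_congr rfl
      intro Y _
      have hY := Finset.mem_powersetCard.1 Y.2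
      rw [ext0_of_card f hY.2, ext0_of_card g (hcard _ hY.1 hY.2)]
    · intro Y hY hY'
      rw [ext0_of_card_ne f, zero_mul]
      intro hc
      exact hY' (Finset.mem_powersetCard.2 ⟨Finset.mem_powerset.1 hY, hc⟩)
  · rw [ext0_of_card_ne _ h]
    symm
    apply Finset.sum_eq_zero
    intro Y hY
    by_cases h1 : Y.card = m
    · rw [ext0_of_card_ne g, mul_zero]
      intro h2
      have := Finset.card_sdiff_add_card_eq_card (Finset.mem_powerset.1 hY)
      omega
    · rw [ext0_of_card_ne f h1, zero_mul]

/-- The constant `c` as an element of `V_0(G)`. -/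
def vconst (c : K) : V K G Ω 0 := ⟨fun _ => c, fun _ _ => rfl⟩

theorem ext0_const (c : K) (X : Finset Ω) :
    ext0 (vconst c : V K G Ω 0) X = if X = ∅ then c else 0 := by
  by_cases h : X = ∅
  · subst h
    rw [if_pos rfl, ext0_of_card _ Finset.card_empty]
    rfl
  · rw [if_neg h, ext0_of_card_ne _ (by rwa [Ne, Finset.card_eq_zero])]

theorem ext0_add {n : ℕ} (f g : V K G Ω n) (X : Finset Ω) :
    ext0 (f + g) X = ext0 f X + ext0 g X := by
  unfold ext0
  split_ifs <;> simp

theorem ext0_zero {n : ℕ} (X : Finset Ω) : ext0 (0 : V K G Ω n) X = 0 := by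
  unfold ext0
  split_ifs <;> simp

theorem ext0_smul_left {n : ℕ} (c : K) (f : V K G Ω n) (X : Finset Ω) :
    ext0 (c • f) X = c * ext0 f X := by
  unfold ext0
  split_ifs <;> simp

theorem ext0_const_mul {n : ℕ} (c : K) (f : V K G Ω n) (X : Finset Ω) :
    ext0 (vmul (vconst c) f) X = c * ext0 f X := by
  rw [ext0_mul, Finset.sum_eq_single ∅]
  · simp [ext0_const]
  · intro Y _ hY
    simp [ext0_const, hY]
  · intro h
    exact absurd (Finset.empty_mem_powerset X) h

theorem ext0_mul_comm {m n : ℕ} (f : V K G Ω m) (g : V K G Ω n) (X : Finset Ω) :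
    ext0 (vmul f g) X = ext0 (vmul g f) X := by
  rw [ext0_mul, ext0_mul]
  refine Finset.sum_bij' (fun Y _ => X \ Y) (fun Y _ => X \ Y) ?_ ?_ ?_ ?_ ?_
  · intro Y _
    exact Finset.mem_powerset.2 Finset.sdiff_subset
  · intro Y _
    exact Finset.mem_powerset.2 Finset.sdiff_subset
  · intro Y hY
    exact Finset.sdiff_sdiff_eq_self (Finset.mem_powerset.1 hY)
  · intro Y hY
    exact Finset.sdiff_sdiff_eq_self (Finset.mem_powerset.1 hY)
  · intro Y hY
    rw [Finset.sdiff_sdiff_eq_self (Finset.mem_powerset.1 hY), mul_comm]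

theorem ext0_mul_assoc {l m n : ℕ} (f : V K G Ω l) (g : V K G Ω m) (h : V K G Ω n)
    (X : Finset Ω) :
    ext0 (vmul (vmul f g) h) X = ext0 (vmul f (vmul g h)) X := by
  simp only [ext0_mul, Finset.sum_mul, Finset.mul_sum]
  rw [Finset.sum_sigma', Finset.sum_sigma']
  refine Finset.sum_bij' (fun p _ => ⟨p.2, p.1 \ p.2⟩) (fun p _ => ⟨p.1 ∪ p.2, p.1⟩) ?_ ?_ ?_ ?_ ?_
  · rintro ⟨Y, Z⟩ hp
    simp only [Finset.mem_sigma, Finset.mem_powerset] at hp ⊢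
    exact ⟨hp.2.trans hp.1, Finset.sdiff_subset_sdiff hp.1 le_rfl⟩
  · rintro ⟨Z, W⟩ hp
    simp only [Finset.mem_sigma, Finset.mem_powerset] at hp ⊢
    exact ⟨Finset.union_subset hp.1 (hp.2.trans Finset.sdiff_subset), Finset.subset_union_left⟩
  · rintro ⟨Y, Z⟩ hp
    simp only [Finset.mem_sigma, Finset.mem_powerset] at hp
    simp only [Finset.union_sdiff_of_subset hp.2]
  · rintro ⟨Z, W⟩ hp
    simp only [Finset.mem_sigma, Finset.mem_powerset] at hp
    have hd : Disjoint W Z := Finset.disjoint_of_subset_left hp.2 Finset.sdiff_disjoint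
    simp only [Finset.union_sdiff_cancel_left hd.symm]
  · rintro ⟨Y, Z⟩ hp
    simp only [Finset.mem_sigma, Finset.mem_powerset] at hp
    have : (X \ Z) \ (Y \ Z) = X \ Y := by
      ext a
      have := @hp.1 a
      have := @hp.2 a
      simp only [Finset.mem_sdiff]
      tauto
    simp only [this, mul_assoc]

instance : GradedMonoid.GMul (fun n => V K G Ω n) := ⟨fun f g => vmul f g⟩

instance : GradedMonoid.GOne (fun n => V K G Ω n) := ⟨vconst 1⟩

theorem gMul_eq {m n : ℕ} (f : V K G Ω m) (g : V K G Ω n) :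
    GradedMonoid.GMul.mul (A := fun n => V K G Ω n) f g = vmul f g := rfl

noncomputable instance : DirectSum.GCommRing (fun n => V K G Ω n) where
  mul_zero f := V_ext fun X => by simp [gMul_eq, ext0_mul, ext0_zero]
  zero_mul f := V_ext fun X => by simp [gMul_eq, ext0_mul, ext0_zero]
  mul_add f g h := V_ext fun X => by
    simp [gMul_eq, ext0_mul, ext0_add, mul_add, Finset.sum_add_distrib]
  add_mul f g h := V_ext fun X => by
    simp [gMul_eq, ext0_mul, ext0_add, add_mul, Finset.sum_add_distrib]
  one_mul := fun ⟨n, f⟩ => gradedMk_eq (zero_add n) fun X => by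
    change ext0 (vmul (vconst 1) f) X = ext0 f X
    rw [ext0_const_mul, one_mul]
  mul_one := fun ⟨n, f⟩ => gradedMk_eq (add_zero n) fun X => by
    change ext0 (vmul f (vconst 1)) X = ext0 f X
    rw [ext0_mul_comm, ext0_const_mul, one_mul]
  mul_assoc := fun ⟨_, f⟩ ⟨_, g⟩ ⟨_, h⟩ => gradedMk_eq (add_assoc _ _ _) (ext0_mul_assoc f g h)
  mul_comm := fun ⟨_, f⟩ ⟨_, g⟩ => gradedMk_eq (add_comm _ _) (ext0_mul_comm f g)
  natCast n := vconst n
  natCast_zero := Subtype.ext (funext fun _ => Nat.cast_zero)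
  natCast_succ n := Subtype.ext (funext fun _ => Nat.cast_succ n)
  intCast n := vconst n
  intCast_ofNat n := Subtype.ext (funext fun _ => Int.cast_natCast n)
  intCast_negSucc_ofNat n := Subtype.ext (funext fun _ => Int.cast_negSucc n)

noncomputable instance : DirectSum.GAlgebra K (fun n => V K G Ω n) where
  toFun :=
    { toFun := vconst
      map_zero' := rfl
      map_add' := fun _ _ => rfl }
  map_one := rfl
  map_mul r s := gradedMk_eq (zero_add 0).symm fun X => by
    change ext0 (vconst (r * s) : V K G Ω 0) X = ext0 (vmul (vconst r) (vconst s)) X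
    rw [ext0_const_mul, ext0_const, ext0_const]
    simp
  commutes := fun r ⟨_, f⟩ => gradedMk_eq (add_comm _ _) (ext0_mul_comm (vconst r) f)
  smul_def := fun r ⟨n, f⟩ => gradedMk_eq (zero_add n).symm fun X => by
    change ext0 (r • f) X = ext0 (vmul (vconst r) f) X
    rw [ext0_const_mul, ext0_smul_left]

variable (K G Ω)

/-- Cameron's algebra `A(G) = ⨁ₙ V_n(G)`, a commutative graded `K`-algebra. -/
abbrev A : Type (max v x) := ⨁ n : ℕ, V K G Ω n

variable {G Ω}

open Classical in
/-- The characteristic function of an orbit `o` on finite subsets: the element of `A(G)`,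
homogeneous of degree the size of the members of `o`, which is `1` on `o` and `0` elsewhere. -/
noncomputable def charFn (o : SetOrbit G Ω) : A K G Ω :=
  DirectSum.of (fun n => V K G Ω n) o.size
    ⟨fun X => if orbitOf G X.1 = o then 1 else 0, fun g X => by
      simp only [Set.powersetCard.coe_smul, orbitOf_smul]⟩

end Algebra

/-! ### Connected blocks, wreath-`A`-like groups and Lyndon words -/

/-- A set of connected blocks: each has a positive integral weight, and they are well-ordered,
firstly by weight and then by some well-ordering of the blocks of each given weight. -/
class ConnectedBlocks (B : Type w) extends LinearOrder B, WellFoundedLT B where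
  wt : B → ℕ
  wt_pos : ∀ b, 0 < wt b
  lt_of_wt_lt : ∀ b c, wt b < wt c → b < c

/-- The weight of a sequence of connected blocks. -/
def seqWt {B : Type w} [ConnectedBlocks B] (s : List B) : ℕ := (s.map ConnectedBlocks.wt).sum

/-- The data exhibiting the action of `G` on `Ω` as wreath-`A`-like with set of connected
blocks `B`. -/
structure WreathALike (G : Type u) [Group G] (Ω : Type v) [DecidableEq Ω] [MulAction G Ω]
    (B : Type w) [ConnectedBlocks B] where
  /-- The bijection from orbits on finite subsets to finite sequences of connected blocks. -/
  φ : SetOrbit G Ω ≃ List B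
  wt_φ : ∀ Y : Finset Ω, seqWt (φ (orbitOf G Y)) = Y.card
  /-- Every finite `Y` is an ordered disjoint union of pieces `P l`, one for each term of `φ Y`
  and of that term's weight, such that for all `Q l ⊆ P l` with union `Z` the sequence `φ Z` is
  a concatenation of sequences `S l` with weight `|Q l|`, where `S l` is the one-term sequence
  of the `l`-th term of `φ Y` whenever `Q l = P l`. -/
  decomp : ∀ Y : Finset Ω, ∃ P : Fin (φ (orbitOf G Y)).length → Finset Ω,
    (∀ i j, i ≠ j → Disjoint (P i) (P j)) ∧
    Finset.univ.biUnion P = Y ∧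
    (∀ l, (P l).card = ConnectedBlocks.wt ((φ (orbitOf G Y)).get l)) ∧
    ∀ Q : Fin (φ (orbitOf G Y)).length → Finset Ω, (∀ l, Q l ⊆ P l) →
      ∃ S : Fin (φ (orbitOf G Y)).length → List B,
        φ (orbitOf G (Finset.univ.biUnion Q)) = (List.ofFn S).flatten ∧
        ∀ l, seqWt (S l) = (Q l).card ∧ (Q l = P l → S l = [(φ (orbitOf G Y)).get l])

/-- A Lyndon word: a non-empty word that is lexicographically smaller than each of its
nontrivial proper right factors. -/
def IsLyndon {B : Type w} [LinearOrder B] (s : List B) : Prop :=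
  s ≠ [] ∧ ∀ u v : List B, u ≠ [] → v ≠ [] → s = u ++ v → s < v

end PermAlg

namespace PermAlg

/-! ### Lyndon factorisations -/

section Lyndon

variable {B : Type*} [LinearOrder B]

/-! Products of the `χ_l` over Lyndon words are triangular with respect to the `χ_w`. Every word is
a product of a unique non-increasing sequence of Lyndon words (`exists_lyndon_factorization`,
`lyndon_factorization_unique`), so monomials in Lyndon words correspond to words: the monomial with
factors `L` has leading word `L.flatten`.

The value of such a monomial at `X` is the number of ways to split `X` into pieces whose words are
the factors (`exists_ev_prod_charFn`); in characteristic zero it vanishes only if there is no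
splitting. A set with word `L.flatten` splits (`splits_of_word_eq_flatten`). Conversely, if `X`
splits, its word has weight that of `L.flatten` and is at most `L.flatten` when words are compared
by length and then lexicographically (`lenLex_word_le`). Indeed the word of `X` is no longer than
the product, and at equal length it is a shuffle of the factors (`shuffle_of_colouring`); the
greatest shuffle of Lyndon words is their non-increasing product (`shuffle_le`). Generation follows
by minimal counterexample among the finitely many words of one weight, and independence by looking
at a greatest leading word.

The shuffle bound is proved numerically. Letters become digits and words discounted sums, so that
lexicographic order becomes the order of numbers. Each factor is replaced by a constant sequence of
equal value. Since suffixes of a Lyndon word are large, interleaving other letters can only lose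
against these constants, and the constants themselves are best arranged in non-increasing order. -/

theorem lt_append_of_lt {s t : List B} (h : s < t) :
    s <+: t ∨ ∀ x y : List B, s ++ x < t ++ y := by
  induction s generalizing t with
  | nil => exact Or.inl List.nil_prefix
  | cons a s ih =>
    cases t with
    | nil => exact absurd h (List.not_lt_nil _)
    | cons b t =>
      rcases List.cons_lt_cons_iff.1 h with hab | ⟨rfl, hst⟩
      · exact Or.inr fun x y => List.cons_lt_cons_iff.2 (Or.inl hab)
      · rcases ih hst with hp | hx
        · exact Or.inl ((List.prefix_cons_inj a).2 hp)
        · exact Or.inr fun x y => List.cons_lt_cons_iff.2 (Or.inr ⟨rfl, hx x y⟩)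

theorem append_lt_append_iff_left (l : List B) {s t : List B} : l ++ s < l ++ t ↔ s < t := by
  induction l with
  | nil => rfl
  | cons a l ih => simp [ih]

theorem append_le_append_iff_left (l : List B) {s t : List B} : l ++ s ≤ l ++ t ↔ s ≤ t := by
  rw [← not_lt, ← not_lt, append_lt_append_iff_left]

theorem self_le_append (s t : List B) : s ≤ s ++ t := by
  conv_lhs => rw [← List.append_nil s]
  rw [append_le_append_iff_left]
  exact not_lt.1 (List.not_lt_nil t)

theorem IsLyndon.le_of_suffix {s v : List B} (h : IsLyndon s) (hv : v ≠ []) (hs : v <:+ s) :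
    s ≤ v := by
  obtain ⟨u, rfl⟩ := hs
  by_cases hu : u = []
  · subst hu
    exact le_rfl
  · exact (h.2 u v hu hv rfl).le

theorem suffix_append_cases {α : Type*} {v a b : List α} (h : v <:+ a ++ b) :
    v <:+ b ∨ ∃ v', v' ≠ [] ∧ v' <:+ a ∧ v = v' ++ b := by
  obtain ⟨t, ht⟩ := h
  rcases List.append_eq_append_iff.1 ht with ⟨c, rfl, rfl⟩ | ⟨c, rfl, hc⟩
  · by_cases hc : c = []
    · subst hc
      exact Or.inl List.suffix_rfl
    · exact Or.inr ⟨c, hc, ⟨t, rfl⟩, rfl⟩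
  · exact Or.inl ⟨c, hc.symm⟩

/-- The last factor of a non-increasing product of Lyndon words is the least non-empty suffix. -/
theorem last_le_of_suffix {M : List (List B)} {p : List B} (hp : IsLyndon p)
    (hM : ∀ l ∈ M, IsLyndon l) (hle : ∀ l ∈ M, p ≤ l) {v : List B} (hv : v ≠ [])
    (hs : v <:+ M.flatten ++ p) : p ≤ v := by
  induction M generalizing v with
  | nil => exact hp.le_of_suffix hv hs
  | cons l M ih =>
    simp only [List.mem_cons, forall_eq_or_imp] at hM hle
    rw [List.flatten_cons, List.append_assoc] at hs
    rcases suffix_append_cases hs with h | ⟨v', hv', hs', rfl⟩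
    · exact ih hM.2 hle.2 hv h
    · exact hle.1.trans ((hM.1.le_of_suffix hv' hs').trans (self_le_append _ _))

theorem flatten_eq_nil_of_lyndon {L : List (List B)} (hL : ∀ l ∈ L, IsLyndon l)
    (h : L.flatten = []) : L = [] := by
  cases L with
  | nil => rfl
  | cons l L =>
    rw [List.flatten_cons, List.append_eq_nil_iff] at h
    exact absurd h.1 (hL l List.mem_cons_self).1

/-- A word has at most one factorisation into a non-increasing sequence of Lyndon words. -/
theorem lyndon_factorization_unique {L L' : List (List B)} (hL : ∀ l ∈ L, IsLyndon l)
    (hL' : ∀ l ∈ L', IsLyndon l) (hs : L.Pairwise (· ≥ ·)) (hs' : L'.Pairwise (· ≥ ·))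
    (h : L.flatten = L'.flatten) : L = L' := by
  induction L using List.reverseRecOn generalizing L' with
  | nil => exact (flatten_eq_nil_of_lyndon hL' h.symm).symm
  | append_singleton M p ih =>
    rcases List.eq_nil_or_concat' L' with rfl | ⟨M', p', rfl⟩
    · exact flatten_eq_nil_of_lyndon hL h
    · simp only [List.mem_append, List.mem_singleton, List.pairwise_append, List.pairwise_singleton,
        forall_eq, true_and, or_imp, forall_and, List.flatten_append,
        List.flatten_singleton] at hL hL' hs hs' h
      -- Each last factor is the least non-empty suffix of the same word.
      have hpp : p = p' := le_antisymm
        (last_le_of_suffix hL.2 hL.1 hs.2 hL'.2.1 (h ▸ List.suffix_append _ _))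
        (last_le_of_suffix hL'.2 hL'.1 hs'.2 hL.2.1 (h ▸ List.suffix_append _ _))
      subst hpp
      rw [ih hL.1 hL'.1 hs.1 hs'.1 (List.append_cancel_right h)]

theorem exists_least_suffix {w : List B} (hw : w ≠ []) :
    ∃ p, p ≠ [] ∧ p <:+ w ∧ ∀ v, v ≠ [] → v <:+ w → p ≤ v := by
  obtain ⟨p, hp, hmin⟩ := (w.tails.toFinset.filter (· ≠ [])).exists_min_image id
    ⟨w, by simp [hw]⟩
  simp only [Finset.mem_filter, List.mem_toFinset, List.mem_tails] at hp hmin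
  exact ⟨p, hp.2, hp.1, fun v hv hs => hmin v ⟨hs, hv⟩⟩

/-- Every word is the product of a non-increasing sequence of Lyndon words. -/
theorem exists_lyndon_factorization (w : List B) :
    ∃ L : List (List B), (∀ l ∈ L, IsLyndon l) ∧ L.Pairwise (· ≥ ·) ∧ L.flatten = w := by
  induction hn : w.length using Nat.strong_induction_on generalizing w with
  | _ n ih =>
    by_cases hw : w = []
    · exact ⟨[], by simp, List.Pairwise.nil, by simp [hw]⟩
    -- The least non-empty suffix is Lyndon, because its own suffixes are suffixes of the word; it
    -- serves as last factor.
    obtain ⟨p, hp, ⟨w', rfl⟩, hmin⟩ := exists_least_suffix hw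
    have hlt : ∀ v, v ≠ [] → v <:+ p → v ≠ p → p < v := fun v hv hs hne =>
      lt_of_le_of_ne (hmin v hv (hs.trans (List.suffix_append _ _))) hne.symm
    have hpl : IsLyndon p := by
      refine ⟨hp, fun u v hu hv h => hlt v hv ⟨u, h.symm⟩ ?_⟩
      rintro rfl
      exact hu (List.append_left_eq_self.1 h.symm)
    have hlen : w'.length < n := by
      rw [← hn, List.length_append]
      have := List.length_pos_iff.2 hp
      omega
    obtain ⟨L, hL, hs, rfl⟩ := ih _ hlen w' rfl
    refine ⟨L ++ [p], by simpa [or_imp, forall_and] using ⟨hL, hpl⟩, ?_, by simp⟩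
    rcases List.eq_nil_or_concat' L with rfl | ⟨M, l, rfl⟩
    · simp
    · suffices hpl : p ≤ l by
        rw [List.pairwise_append]
        refine ⟨hs, List.pairwise_singleton _ _, fun a ha b hb => ?_⟩
        rw [List.mem_singleton] at hb
        subst hb
        rw [List.pairwise_append] at hs
        rcases List.mem_append.1 ha with ha | ha
        · exact hpl.trans (hs.2.2 a ha l (List.mem_singleton_self l))
        · rw [List.mem_singleton] at ha
          exact ha ▸ hpl
      by_contra hlp
      rw [not_le] at hlp
      have hl : l ≠ [] := (hL l (by simp)).1
      -- Suppose `l < p`. If `l` is a prefix, `p = l ++ q`, cancelling `l` gives `q ≤ p` for a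
      -- proper suffix `q` of `p`; otherwise the first difference gives `l ++ p < p`. Both
      -- contradict minimality of `p`.
      have h1 : p ≤ l ++ p := hmin _ (by simp [hp]) ⟨M.flatten, by simp⟩
      rcases lt_append_of_lt hlp with ⟨q, rfl⟩ | h
      · rw [append_le_append_iff_left] at h1
        have hq : q ≠ [] := by
          rintro rfl
          simp at hlp
        refine absurd (hlt q hq (List.suffix_append _ _) ?_) (not_lt.2 h1)
        intro h
        exact hl (List.append_left_eq_self.1 h.symm)
      · have := h p []
        rw [List.append_nil] at this
        exact absurd h1 (not_le.2 this)

end Lyndon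

end PermAlg

namespace PermAlg

/-! ### The lexicographically greatest shuffle of Lyndon words -/

section Discounted

/-- The discounted value `∑ xₜ rᵗ⁺¹` of a sequence of rationals. -/
def disc (r : ℚ) : List ℚ → ℚ
  | [] => 0
  | x :: s => r * (x + disc r s)

theorem disc_append (r : ℚ) (s t : List ℚ) :
    disc r (s ++ t) = disc r s + r ^ s.length * disc r t := by
  induction s with
  | nil => simp [disc]
  | cons x s ih =>
    simp only [List.cons_append, disc, ih, List.length_cons]
    ring

theorem disc_map_const (r : ℚ) {α : Type*} (s : List α) (c : ℚ) :
    (1 - r) * disc r (s.map fun _ => c) = c * r * (1 - r ^ s.length) := by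
  induction s with
  | nil => simp [disc]
  | cons x s ih =>
    simp only [List.map_cons, disc, List.length_cons, pow_succ]
    linear_combination r * ih

theorem disc_map_sub (r : ℚ) {α : Type*} (s : List α) (f g : α → ℚ) :
    disc r (s.map fun a => f a - g a) = disc r (s.map f) - disc r (s.map g) := by
  induction s with
  | nil => simp [disc]
  | cons x s ih =>
    simp only [List.map_cons, disc, ih]
    ring

theorem disc_map_sum (r : ℚ) {α ι : Type*} (I : Finset ι) (s : List α) (f : ι → α → ℚ) :
    disc r (s.map fun a => ∑ i ∈ I, f i a) = ∑ i ∈ I, disc r (s.map (f i)) := by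
  induction s with
  | nil => simp [disc]
  | cons x s ih =>
    simp only [List.map_cons, disc, ih, ← Finset.mul_sum, Finset.sum_add_distrib]

variable {r : ℚ}

/-- Moving a greatest term to the front does not decrease the discounted value. -/
theorem disc_middle_le (hr0 : 0 < r) (hr1 : r < 1) {x : ℚ} {s : List ℚ} (t : List ℚ)
    (h : ∀ y ∈ s, y ≤ x) : disc r (s ++ x :: t) ≤ disc r (x :: (s ++ t)) := by
  induction s with
  | nil => exact le_rfl
  | cons y s ih =>
    simp only [List.mem_cons, forall_eq_or_imp] at h
    have := ih h.2
    simp only [List.cons_append, disc] at this ⊢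
    have h1 : y + disc r (s ++ x :: t) ≤ x + r * (y + disc r (s ++ t)) := by
      nlinarith [mul_nonneg (sub_nonneg.2 hr1.le) (sub_nonneg.2 h.1)]
    exact mul_le_mul_of_nonneg_left h1 hr0.le

/-- A rearrangement inequality: the discounts decrease along the sequence, so greatest terms are
best placed first, one after another. -/
theorem disc_le_of_perm (hr0 : 0 < r) (hr1 : r < 1) {s t : List ℚ} (h : s.Perm t)
    (ht : t.Pairwise (· ≥ ·)) : disc r s ≤ disc r t := by
  induction t generalizing s with
  | nil => rw [h.eq_nil]
  | cons x t ih =>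
    obtain ⟨s₁, s₂, rfl⟩ := List.append_of_mem (h.symm.subset List.mem_cons_self)
    have hp : (s₁ ++ s₂).Perm t := (List.perm_middle.symm.trans h).cons_inv
    rw [List.pairwise_cons] at ht
    refine (disc_middle_le hr0 hr1 s₂ fun y hy =>
      ht.1 y (hp.subset (List.mem_append_left _ hy))).trans ?_
    simp only [disc]
    exact mul_le_mul_of_nonneg_left (by linarith [ih hp ht.2]) hr0.le

/-- Delaying the terms of a sequence whose suffixes have non-negative value does not increase
its value. -/
theorem disc_filter_le (hr0 : 0 < r) (hr1 : r < 1) {α : Type*} (p : α → Bool) (e : α → ℚ)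
    (z : List α) (h : ∀ v, v <:+ z.filter p → 0 ≤ disc r (v.map e)) :
    disc r (z.map fun a => if p a then e a else 0) ≤ disc r ((z.filter p).map e) := by
  induction z with
  | nil => exact le_rfl
  | cons a z ih =>
    by_cases ha : p a
    · rw [List.filter_cons_of_pos ha] at h ⊢
      have := ih fun v hv => h v (hv.trans (List.suffix_cons _ _))
      simp only [List.map_cons, disc, ha, if_true]
      exact mul_le_mul_of_nonneg_left (by linarith) hr0.le
    · rw [List.filter_cons_of_neg ha] at h ⊢
      have h1 := ih h
      -- A skipped position multiplies the remaining value by `r < 1`, which is no gain because that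
      -- value is bounded by a non-negative one.
      have h2 := h _ List.suffix_rfl
      simp only [List.map_cons, disc, ha]
      simp only [Bool.false_eq_true, if_false, zero_add]
      nlinarith

end Discounted

/-! ### Words as numbers, and the greatest shuffle -/

section Encoding

variable {B : Type*} [LinearOrder B]

/-- `f` encodes the letters in `F` as digits in base `r⁻¹`, none of them `0`. -/
structure IsDigits (F : Finset B) (f : B → ℚ) (r : ℚ) : Prop where
  pos : 0 < r
  lt_one : r < 1
  one_le : ∀ a ∈ F, 1 ≤ f a
  bound : ∀ a ∈ F, r * (f a + 1) ≤ 1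
  add_one_le : ∀ a ∈ F, ∀ b ∈ F, a < b → f a + 1 ≤ f b

theorem exists_isDigits (F : Finset B) : ∃ f r, IsDigits F f r := by
  -- The digit of a letter is its rank in `F`, counted from 1; base `F.card + 2` leaves room for the
  -- largest digit plus one.
  refine ⟨fun a => ((F.filter (· ≤ a)).card : ℚ), ((F.card : ℚ) + 2)⁻¹,
    by positivity, ?_, ?_, ?_, ?_⟩
  · exact inv_lt_one_of_one_lt₀ (by linarith [(Nat.cast_nonneg F.card : (0 : ℚ) ≤ _)])
  · intro a ha
    exact_mod_cast Finset.card_pos.2 ⟨a, by simp [ha]⟩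
  · intro a _
    rw [inv_mul_le_iff₀ (by positivity), mul_one]
    have : ((F.filter (· ≤ a)).card : ℚ) ≤ F.card := by
      exact_mod_cast Finset.card_filter_le _ _
    linarith
  · intro a _ b hb hab
    have : (F.filter (· ≤ a)).card < (F.filter (· ≤ b)).card := by
      apply Finset.card_lt_card
      rw [Finset.ssubset_iff_of_subset]
      · exact ⟨b, by simp [hb], by simp [hab]⟩
      · exact fun c hc => by
          simp only [Finset.mem_filter] at hc ⊢
          exact ⟨hc.1, hc.2.trans hab.le⟩
    exact_mod_cast this

variable {F : Finset B} {f : B → ℚ} {r : ℚ}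

theorem IsDigits.disc_nonneg (h : IsDigits F f r) {s : List B} (hs : ∀ a ∈ s, a ∈ F) :
    0 ≤ disc r (s.map f) := by
  induction s with
  | nil => exact le_rfl
  | cons a s ih =>
    simp only [List.mem_cons, forall_eq_or_imp] at hs
    exact mul_nonneg h.pos.le (by linarith [ih hs.2, h.one_le a hs.1])

theorem IsDigits.disc_lt_one (h : IsDigits F f r) {s : List B} (hs : ∀ a ∈ s, a ∈ F) :
    disc r (s.map f) < 1 := by
  induction s with
  | nil => exact one_pos
  | cons a s ih =>
    simp only [List.mem_cons, forall_eq_or_imp] at hs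
    refine lt_of_lt_of_le ?_ (h.bound a hs.1)
    exact mul_lt_mul_of_pos_left (by linarith [ih hs.2]) h.pos

/-- The first differing letter decides: its digits differ by at least one, while all that follows is
worth less than one. A proper prefix is strictly smaller because no digit is zero. -/
theorem IsDigits.disc_lt_disc (h : IsDigits F f r) {s t : List B} (hs : ∀ a ∈ s, a ∈ F)
    (ht : ∀ a ∈ t, a ∈ F) (hst : s < t) : disc r (s.map f) < disc r (t.map f) := by
  induction s generalizing t with
  | nil =>
    cases t with
    | nil => exact absurd hst (lt_irrefl _)
    | cons b t =>
      simp only [List.mem_cons, forall_eq_or_imp] at ht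
      exact mul_pos h.pos (by linarith [h.disc_nonneg ht.2, h.one_le b ht.1])
  | cons a s ih =>
    cases t with
    | nil => exact absurd hst (List.not_lt_nil _)
    | cons b t =>
      simp only [List.mem_cons, forall_eq_or_imp] at hs ht
      refine mul_lt_mul_of_pos_left ?_ h.pos
      rcases List.cons_lt_cons_iff.1 hst with hab | ⟨rfl, hst'⟩
      · linarith [h.add_one_le a hs.1 b ht.1 hab, h.disc_lt_one hs.2, h.disc_nonneg ht.2]
      · linarith [ih hs.2 ht.2 hst']

theorem IsDigits.disc_le_disc (h : IsDigits F f r) {s t : List B} (hs : ∀ a ∈ s, a ∈ F)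
    (ht : ∀ a ∈ t, a ∈ F) (hst : s ≤ t) : disc r (s.map f) ≤ disc r (t.map f) := by
  rcases hst.lt_or_eq with hst | rfl
  · exact (h.disc_lt_disc hs ht hst).le
  · exact le_rfl

theorem IsDigits.one_sub_pow_pos (h : IsDigits F f r) {n : ℕ} (hn : n ≠ 0) : 0 < 1 - r ^ n :=
  sub_pos.2 (pow_lt_one₀ h.pos.le h.lt_one hn)

/-- The constant whose repetition has the same discounted value as the word `l`. -/
def meanDigit (f : B → ℚ) (r : ℚ) (l : List B) : ℚ :=
  (1 - r) * disc r (l.map f) / (r * (1 - r ^ l.length))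

theorem IsDigits.disc_meanDigit (h : IsDigits F f r) (l : List B) {α : Type*} (v : List α) :
    disc r (v.map fun _ => meanDigit f r l) =
      disc r (l.map f) * ((1 - r ^ v.length) / (1 - r ^ l.length)) := by
  have h1 : (1 - r) ≠ 0 := (sub_pos.2 h.lt_one).ne'
  have hr := h.pos.ne'
  apply mul_left_cancel₀ h1
  rw [disc_map_const, meanDigit]
  field_simp

/-- A suffix `v` of a Lyndon word `l` satisfies `l ≤ v`, so it is worth at least as much as `l`,
whereas the constant `meanDigit f r l` repeated over the shorter length is worth at most as much. -/
theorem IsDigits.suffix_excess_nonneg (h : IsDigits F f r) {l : List B} (hl : IsLyndon l)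
    (hF : ∀ a ∈ l, a ∈ F) {v : List B} (hv : v <:+ l) :
    0 ≤ disc r (v.map fun a => f a - meanDigit f r l) := by
  by_cases hv0 : v = []
  · subst hv0
    exact le_rfl
  have hvF : ∀ a ∈ v, a ∈ F := fun a ha => hF a (hv.subset ha)
  have hl0 : l.length ≠ 0 := by simpa using hl.1
  rw [disc_map_sub r v f fun _ => meanDigit f r l, h.disc_meanDigit]
  have h1 : (1 - r ^ v.length) / (1 - r ^ l.length) ≤ 1 := by
    rw [div_le_one (h.one_sub_pow_pos hl0)]
    linarith [pow_le_pow_of_le_one h.pos.le h.lt_one.le hv.length_le]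
  have h2 := h.disc_le_disc hF hvF (hl.le_of_suffix hv0 hv)
  linarith [mul_le_of_le_one_right (h.disc_nonneg hF) h1]

/-- The first difference decides unless `l = m ++ v`; then cancelling `m` leaves `l ≤ v ++ m`, which
holds since `l < v` for a proper suffix. -/
theorem IsLyndon.append_le_append {l m : List B} (hl : IsLyndon l) (h : m ≤ l) :
    m ++ l ≤ l ++ m := by
  rcases h.lt_or_eq with h | rfl
  · rcases lt_append_of_lt h with ⟨v, rfl⟩ | h
    · by_cases hm : m = []
      · simp [hm]
      have hv : v ≠ [] := by
        rintro rfl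
        simp at h
      rw [List.append_assoc, append_le_append_iff_left]
      exact (hl.2 m v hm hv rfl).le.trans (self_le_append _ _)
    · exact (h _ _).le
  · exact le_rfl

/-- The discounted form of `m ++ l ≤ l ++ m`, rearranged, is exactly the comparison of the two
constants. -/
theorem IsDigits.meanDigit_le (h : IsDigits F f r) {l m : List B} (hl : IsLyndon l)
    (hm : IsLyndon m) (hlF : ∀ a ∈ l, a ∈ F) (hmF : ∀ a ∈ m, a ∈ F) (hle : m ≤ l) :
    meanDigit f r m ≤ meanDigit f r l := by
  have h1 := h.disc_le_disc (by simpa [or_imp, forall_and] using ⟨hmF, hlF⟩)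
    (by simpa [or_imp, forall_and] using ⟨hlF, hmF⟩) (hl.append_le_append hle)
  simp only [List.map_append, disc_append, List.length_map] at h1
  have hl0 := h.one_sub_pow_pos (n := l.length) (by simpa using hl.1)
  have hm0 := h.one_sub_pow_pos (n := m.length) (by simpa using hm.1)
  have hr := h.pos
  have hr1 := sub_pos.2 h.lt_one
  rw [meanDigit, meanDigit, div_le_div_iff₀ (by positivity) (by positivity)]
  have h2 : disc r (m.map f) * (1 - r ^ l.length) ≤ disc r (l.map f) * (1 - r ^ m.length) := by
    linarith
  have h3 := mul_le_mul_of_nonneg_left h2 (mul_pos hr1 hr).le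
  linarith

/-- Replacing each factor by a constant sequence of the same length and value leaves the discounts
of the later factors unchanged. -/
theorem disc_flatten_eq {α ι : Type*} (f : α → ℚ) (r : ℚ) (I : List ι) (ℓ : ι → List α)
    (g : ι → ℚ)
    (h : ∀ i ∈ I, disc r ((ℓ i).map fun _ => g i) = disc r ((ℓ i).map f)) :
    disc r (((I.map fun i => List.replicate (ℓ i).length i).flatten).map g) =
      disc r (((I.map ℓ).flatten).map f) := by
  induction I with
  | nil => rfl
  | cons i I ih =>
    simp only [List.mem_cons, forall_eq_or_imp] at h
    simp only [List.map_cons, List.flatten_cons, List.map_append, disc_append, ih h.2, ← h.1,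
      List.map_replicate, List.length_replicate, List.length_map, List.map_const']

theorem perm_colours {α : Type*} {k : ℕ} {ℓ : ℕ → List α} {z : List (α × ℕ)}
    (hz : ∀ p ∈ z, p.2 < k)
    (hf : ∀ i < k, (z.filter (·.2 = i)).map Prod.fst = ℓ i) :
    (z.map Prod.snd).Perm
      ((List.range k).map fun i => List.replicate (ℓ i).length i).flatten := by
  rw [List.perm_iff_count]
  intro i
  have h1 : ((z.map Prod.snd).count i) = (z.filter (·.2 = i)).length := by
    rw [List.count, List.countP_map, List.countP_eq_length_filter]
    congr 2
  rw [h1, List.count_flatten, List.map_map]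
  have h2 : (List.count i ∘ fun i => List.replicate (ℓ i).length i) =
      fun j => if j = i then (ℓ i).length else 0 := by
    funext j
    by_cases hj : j = i
    · simp [hj]
    · simp [List.count_replicate, hj]
  rw [h2]
  have h3 : ((List.range k).map fun j => if j = i then (ℓ i).length else 0).sum =
      ∑ j ∈ Finset.range k, if j = i then (ℓ i).length else 0 := rfl
  rw [h3, Finset.sum_ite_eq']
  by_cases hi : i < k
  · simp [hi, ← hf i hi]
  · rw [if_neg (by simpa using hi), List.length_eq_zero_iff, List.filter_eq_nil_iff]
    intro p hp
    have := hz p hp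
    simp only [decide_eq_true_eq]
    omega

/-- Every shuffle of Lyndon words `ℓ 0 ≥ ℓ 1 ≥ ⋯ ≥ ℓ (k - 1)` is at most their product in this
order. The shuffle is given by a word `z` whose letters are coloured with the indices. -/
theorem shuffle_le {k : ℕ} {ℓ : ℕ → List B} (hL : ∀ i < k, IsLyndon (ℓ i))
    (hs : ∀ i j, i < j → j < k → ℓ j ≤ ℓ i) {z : List (B × ℕ)} (hz : ∀ p ∈ z, p.2 < k)
    (hf : ∀ i < k, (z.filter (·.2 = i)).map Prod.fst = ℓ i) :
    z.map Prod.fst ≤ ((List.range k).map ℓ).flatten := by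
  obtain ⟨f, r, h⟩ := exists_isDigits (z.map Prod.fst).toFinset
  set F := (z.map Prod.fst).toFinset with hFdef
  have hzF : ∀ a ∈ z.map Prod.fst, a ∈ F := fun a ha => List.mem_toFinset.2 ha
  have hlF : ∀ i < k, ∀ a ∈ ℓ i, a ∈ F := by
    intro i hi a ha
    rw [← hf i hi] at ha
    exact hzF a (List.map_subset _ (List.filter_subset_self _) ha)
  by_contra hlt
  rw [not_le] at hlt
  have hlF' : ∀ a ∈ ((List.range k).map ℓ).flatten, a ∈ F := by
    intro a ha
    simp only [List.mem_flatten, List.mem_map, List.mem_range] at ha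
    obtain ⟨_, ⟨i, hi, rfl⟩, ha⟩ := ha
    exact hlF i hi a ha
  refine absurd (h.disc_lt_disc hlF' hzF hlt) (not_lt.2 ?_)
  set g : ℕ → ℚ := fun i => meanDigit f r (ℓ i) with hg
  have hzero : ∀ i < k, disc r ((ℓ i).map fun _ => g i) = disc r ((ℓ i).map f) := by
    intro i hi
    rw [h.disc_meanDigit, div_self, mul_one]
    exact (h.one_sub_pow_pos (by simpa using (hL i hi).1)).ne'
  -- The difference of the two sides is a sum over colours of excesses, each delayed by the letters
  -- of other colours. Undelayed, each excess is zero in total, so by `disc_filter_le` each delayed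
  -- one is at most zero.
  have step1 : disc r ((z.map Prod.fst).map f) ≤ disc r ((z.map Prod.snd).map g) := by
    rw [List.map_map, List.map_map, ← sub_nonpos, ← disc_map_sub]
    have : (z.map fun a => (f ∘ Prod.fst) a - (g ∘ Prod.snd) a) =
        z.map fun p => ∑ i ∈ Finset.range k,
          if decide (p.2 = i) then (fun p : B × ℕ => f p.1 - g i) p else 0 := by
      refine List.map_congr_left fun p hp => ?_
      simp [hz p hp]
    rw [this, disc_map_sum]
    refine Finset.sum_nonpos fun i hi => ?_
    have hi := Finset.mem_range.1 hi
    refine (disc_filter_le h.pos h.lt_one (fun p : B × ℕ => decide (p.2 = i)) _ z ?_).trans ?_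
    · intro v hv
      have := h.suffix_excess_nonneg (hL i hi) (hlF i hi) (v := v.map Prod.fst)
        (hf i hi ▸ hv.map _)
      rwa [List.map_map] at this
    · have : (z.filter fun p : B × ℕ => decide (p.2 = i)).map (fun p => f p.1 - g i) =
          (ℓ i).map fun a => f a - g i := by
        rw [← hf i hi, List.map_map]
        rfl
      rw [this, disc_map_sub r _ f fun _ => g i, hzero i hi, sub_self]
  refine step1.trans ?_
  rw [← disc_flatten_eq f r (List.range k) ℓ g fun i hi => hzero i (List.mem_range.1 hi)]
  -- Both sides now involve only the constants, once in the order of the shuffle and once sorted.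
  refine disc_le_of_perm h.pos h.lt_one ((perm_colours hz hf).map g) ?_
  rw [List.pairwise_map, List.pairwise_flatten]
  refine ⟨?_, ?_⟩
  · intro s hs
    obtain ⟨i, -, rfl⟩ := List.mem_map.1 hs
    exact List.pairwise_replicate.2 (Or.inr le_rfl)
  · rw [List.pairwise_map]
    refine List.pairwise_lt_range.imp_of_mem ?_
    intro i j hi hj hij a ha b hb
    rw [List.mem_range] at hi hj
    rw [List.eq_of_mem_replicate ha, List.eq_of_mem_replicate hb]
    exact h.meanDigit_le (hL i hi) (hL j hj) (hlF i hi) (hlF j hj) (hs i j hij hj)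

end Encoding

end PermAlg

namespace PermAlg

/-! ### Values of elements of `A(G)` on finite subsets -/

section Evaluation

variable {K : Type*} [Field K] {G : Type*} [Group G] {Ω : Type*} [DecidableEq Ω] [MulAction G Ω]

variable (K G) in
/-- The value of an element of `A(G)` at a finite subset. -/
def ev (X : Finset Ω) : A K G Ω →ₗ[K] K where
  toFun a := ext0 (a X.card) X
  map_add' a b := by rw [DirectSum.add_apply, ext0_add]
  map_smul' c a := by rw [DirectSum.smul_apply, ext0_smul_left]; rfl

theorem ev_of (X : Finset Ω) {n : ℕ} (f : V K G Ω n) :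
    ev K G X (DirectSum.of (fun n => V K G Ω n) n f) = ext0 f X := by
  change ext0 (DirectSum.of (fun n => V K G Ω n) n f X.card) X = _
  by_cases h : X.card = n
  · subst h
    rw [DirectSum.of_eq_same]
  · rw [DirectSum.of_eq_of_ne _ _ _ h, ext0_zero, ext0_of_card_ne f h]

theorem ev_mul (X : Finset Ω) (a b : A K G Ω) :
    ev K G X (a * b) = ∑ Y ∈ X.powerset, ev K G Y a * ev K G (X \ Y) b := by
  induction a using DirectSum.induction_on with
  | zero =>
    refine (congrArg (ev K G X) (zero_mul b)).trans ((ev K G X).map_zero.trans ?_)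
    simp only [map_zero, zero_mul, Finset.sum_const_zero]
  | add a a' ha ha' =>
    have h := @add_mul (A K G Ω) _ _ (@Distrib.rightDistribClass (A K G Ω) _) a a' b
    refine (congrArg (ev K G X) h).trans (((ev K G X).map_add _ _).trans ?_)
    simp only [map_add, ha, ha', add_mul, Finset.sum_add_distrib]
  | of m f =>
    induction b using DirectSum.induction_on with
    | zero =>
      refine (congrArg (ev K G X) (mul_zero _)).trans ((ev K G X).map_zero.trans ?_)
      simp only [map_zero, mul_zero, Finset.sum_const_zero]
    | add b b' hb hb' =>
      have h (c : A K G Ω) :=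
        @mul_add (A K G Ω) _ _ (@Distrib.leftDistribClass (A K G Ω) _) c b b'
      refine (congrArg (ev K G X) (h _)).trans (((ev K G X).map_add _ _).trans ?_)
      simp only [map_add, hb, hb', mul_add, Finset.sum_add_distrib]
    | of n g =>
      rw [DirectSum.of_mul_of, ev_of]
      simp only [ev_of]
      exact ext0_mul f g X

theorem ev_one (X : Finset Ω) : ev K G X 1 = if X = ∅ then 1 else 0 := by
  rw [DirectSum.one_def, ev_of]
  exact ext0_const 1 X

open Classical in
theorem ev_charFn (X : Finset Ω) (o : SetOrbit G Ω) :
    ev K G X (charFn K o) = if orbitOf G X = o then 1 else 0 := by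
  rw [charFn, ev_of]
  by_cases h : X.card = o.size
  · rw [ext0_of_card _ h]
  · rw [ext0_of_card_ne _ h, if_neg]
    rintro rfl
    exact h rfl

theorem ev_ext {a b : A K G Ω} (h : ∀ X, ev K G X a = ev K G X b) : a = b := by
  refine DFinsupp.ext fun n => V_ext fun X => ?_
  by_cases hX : X.card = n
  · subst hX
    exact h X
  · rw [ext0_of_card_ne _ hX, ext0_of_card_ne _ hX]

theorem ev_eq_of_orbitOf_eq {X Y : Finset Ω} (h : orbitOf G X = orbitOf G Y) (a : A K G Ω) :
    ev K G X a = ev K G Y a := by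
  obtain ⟨g, rfl⟩ := orbitOf_eq_iff.1 h
  change ext0 (a (g • Y).card) (g • Y) = _
  rw [ext0_smul, Finset.card_smul_finset]
  rfl

/-- `X` is a disjoint union of members of the orbits in the list. -/
def Splits : List (SetOrbit G Ω) → Finset Ω → Prop
  | [], X => X = ∅
  | o :: L, X => ∃ Y ⊆ X, orbitOf G Y = o ∧ Splits L (X \ Y)

/-- The value of a product of characteristic functions of orbits counts the ways of splitting. -/
theorem exists_ev_prod_charFn (L : List (SetOrbit G Ω)) (X : Finset Ω) :
    ∃ n : ℕ, ev K G X (L.map (charFn K)).prod = n ∧ (n ≠ 0 ↔ Splits L X) := by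
  classical
  induction L generalizing X with
  | nil =>
    refine ⟨if X = ∅ then 1 else 0, ?_, ?_⟩
    · simp [ev_one]
    · simp [Splits]
  | cons o L ih =>
    choose n hn hs using ih
    refine ⟨∑ Y ∈ X.powerset, if orbitOf G Y = o then n (X \ Y) else 0, ?_, ?_⟩
    · rw [List.map_cons, List.prod_cons, ev_mul, Nat.cast_sum]
      refine Finset.sum_congr rfl fun Y _ => ?_
      rw [ev_charFn, hn]
      split_ifs <;> simp
    · rw [Ne, Finset.sum_eq_zero_iff]
      push Not
      simp only [Splits, ← hs, Finset.mem_powerset]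
      constructor
      · rintro ⟨Y, hY, h⟩
        by_cases ho : orbitOf G Y = o
        · rw [if_pos ho] at h
          exact ⟨Y, hY, ho, h⟩
        · simp [ho] at h
      · rintro ⟨Y, hY, ho, h⟩
        exact ⟨Y, hY, by rwa [if_pos ho]⟩

/-- Colours are positions in the list, so that repeated orbits give distinct pieces. -/
theorem Splits.exists_colouring {L : List (SetOrbit G Ω)} {X : Finset Ω} (h : Splits L X) :
    ∃ c : Ω → ℕ, (∀ x ∈ X, c x < L.length) ∧
      ∀ (i : ℕ) (hi : i < L.length), orbitOf G (X.filter (c · = i)) = L[i] := by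
  induction L generalizing X with
  | nil =>
    rw [Splits] at h
    subst h
    exact ⟨fun _ => 0, by simp, by simp⟩
  | cons o L ih =>
    obtain ⟨Y, hY, ho, h⟩ := h
    obtain ⟨c, hc, hcL⟩ := ih h
    refine ⟨fun x => if x ∈ Y then 0 else c x + 1, ?_, ?_⟩
    · intro x hx
      by_cases hxY : x ∈ Y
      · simp [hxY]
      · simpa [hxY] using hc x (Finset.mem_sdiff.2 ⟨hx, hxY⟩)
    · rintro (_ | i) hi
      · rw [List.getElem_cons_zero, ← ho]
        congr 1
        ext x
        simp only [Finset.mem_filter]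
        constructor
        · rintro ⟨_, hx⟩
          by_contra hxY
          simp [hxY] at hx
        · intro hx
          exact ⟨hY hx, if_pos hx⟩
      · rw [List.getElem_cons_succ, ← hcL i (by simpa using hi)]
        congr 1
        ext x
        simp only [Finset.mem_filter, Finset.mem_sdiff]
        by_cases hxY : x ∈ Y <;> simp [hxY]

end Evaluation

/-! ### Splittings in a wreath-`A`-like action -/

section Lists

theorem map_filter_eq_flatten {α β : Type*} (p : α → Bool) (f : α → β) (l : List α) :
    (l.filter p).map f = (l.map fun a => if p a then [f a] else []).flatten := by
  induction l with
  | nil => rfl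
  | cons a l ih => by_cases h : p a <;> simp [h, ih]

theorem flatten_ofFn_take {α : Type*} (v : List α) (n : ℕ) :
    (List.ofFn fun l : Fin v.length => if (l : ℕ) < n then [v.get l] else []).flatten =
      v.take n := by
  induction v generalizing n with
  | nil => simp
  | cons x v ih =>
    cases n with
    | zero => simp
    | succ n => simpa [List.ofFn_succ] using ih n

theorem flatten_ofFn_drop {α : Type*} (v : List α) (n : ℕ) :
    (List.ofFn fun l : Fin v.length => if ¬ (l : ℕ) < n then [v.get l] else []).flatten =
      v.drop n := by
  induction v generalizing n with
  | nil => simp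
  | cons x v ih =>
    cases n with
    | zero => simpa [List.ofFn_succ] using ih 0
    | succ n => simpa [List.ofFn_succ] using ih n

end Lists

section Wreath

variable {G : Type*} [Group G] {Ω : Type*} [DecidableEq Ω] [MulAction G Ω]
  {B : Type*} [ConnectedBlocks B]

theorem seqWt_append (s t : List B) : seqWt (s ++ t) = seqWt s + seqWt t := by
  simp [seqWt]

theorem seqWt_eq_zero_iff {s : List B} : seqWt s = 0 ↔ s = [] := by
  cases s with
  | nil => simp [seqWt]
  | cons b s =>
    have := ConnectedBlocks.wt_pos b
    simp only [seqWt, List.map_cons, List.sum_cons, reduceCtorEq, iff_false]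
    omega

namespace WreathALike

variable (W : WreathALike G Ω B)

/-- The word of a finite subset. -/
abbrev word (X : Finset Ω) : List B := W.φ (orbitOf G X)

theorem seqWt_word (X : Finset Ω) : seqWt (W.word X) = X.card := W.wt_φ X

theorem word_eq_iff {X : Finset Ω} {w : List B} : W.word X = w ↔ orbitOf G X = W.φ.symm w :=
  (Equiv.eq_symm_apply _).symm

theorem exists_word_eq (w : List B) : ∃ X, W.word X = w := by
  obtain ⟨X, hX⟩ := Quotient.exists_rep (W.φ.symm w)
  exact ⟨X, W.word_eq_iff.2 hX⟩

/-- If the word of `X` is `a ++ b`, then `X` splits into sets with words `a` and `b`. -/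
theorem exists_subset_of_word_eq_append {X : Finset Ω} {a b : List B} (h : W.word X = a ++ b) :
    ∃ Y ⊆ X, W.word Y = a ∧ W.word (X \ Y) = b := by
  obtain ⟨P, hdisj, hX, -, hQ⟩ : ∃ P : Fin (W.word X).length → Finset Ω, _ := W.decomp X
  have hmem : ∀ x, x ∈ X ↔ ∃ l, x ∈ P l := fun x => by
    conv_lhs => rw [← hX]
    simp
  -- When each piece is kept whole or dropped, the concatenation is forced: a kept piece gives its
  -- one block, and a dropped one gives a sequence of weight 0, hence empty.
  have key : ∀ (q : Fin (W.word X).length → Prop) [DecidablePred q],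
      W.word (Finset.univ.biUnion fun l => if q l then P l else ∅) =
        (List.ofFn fun l => if q l then [(W.word X).get l] else []).flatten := by
    intro q _
    obtain ⟨S, hS, hSl⟩ := hQ (fun l => if q l then P l else ∅) fun l => by
      split_ifs
      · exact le_rfl
      · exact Finset.empty_subset _
    refine hS.trans (congrArg (fun f => (List.ofFn f).flatten) (funext fun l => ?_))
    by_cases hl : q l
    · rw [if_pos hl]
      exact (hSl l).2 (if_pos hl)
    · rw [if_neg hl, ← seqWt_eq_zero_iff, (hSl l).1, if_neg hl, Finset.card_empty]
  refine ⟨Finset.univ.biUnion fun l : Fin (W.word X).length =>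
    if (l : ℕ) < a.length then P l else ∅, ?_, ?_, ?_⟩
  · refine Finset.biUnion_subset.2 fun l _ => ?_
    split_ifs
    · exact fun x hx => (hmem x).2 ⟨l, hx⟩
    · exact Finset.empty_subset _
  · rw [key, flatten_ofFn_take, h, List.take_left]
  · have hsd : X \ (Finset.univ.biUnion fun l : Fin (W.word X).length =>
          if (l : ℕ) < a.length then P l else ∅) =
        Finset.univ.biUnion fun l : Fin (W.word X).length =>
          if ¬ (l : ℕ) < a.length then P l else ∅ := by
      ext x
      simp only [Finset.mem_sdiff, hmem, Finset.mem_biUnion, Finset.mem_univ, true_and]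
      constructor
      · rintro ⟨⟨l, hl⟩, hx⟩
        refine ⟨l, ?_⟩
        rw [if_pos]
        · exact hl
        · intro hla
          exact hx ⟨l, by rwa [if_pos hla]⟩
      · rintro ⟨l, hl⟩
        by_cases hla : (l : ℕ) < a.length
        · simp [hla] at hl
        · rw [if_pos hla] at hl
          refine ⟨⟨l, hl⟩, ?_⟩
          rintro ⟨l', hl'⟩
          by_cases hla' : (l' : ℕ) < a.length
          · rw [if_pos hla'] at hl'
            have hne : l' ≠ l := by
              rintro rfl
              exact hla hla'
            exact Finset.disjoint_left.1 (hdisj l' l hne) hl' hl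
          · simp [hla'] at hl'
    rw [hsd, key, flatten_ofFn_drop, h, List.drop_left]

theorem splits_of_word_eq_flatten {L : List (List B)} {X : Finset Ω}
    (h : W.word X = L.flatten) : Splits (L.map W.φ.symm) X := by
  induction L generalizing X with
  | nil =>
    rw [List.map_nil, Splits, ← Finset.card_eq_zero, ← W.seqWt_word, h]
    rfl
  | cons l L ih =>
    obtain ⟨Y, hY, h1, h2⟩ := W.exists_subset_of_word_eq_append h
    exact ⟨Y, hY, W.word_eq_iff.1 h1, ih h2⟩

theorem card_of_splits {L : List (List B)} {X : Finset Ω} (h : Splits (L.map W.φ.symm) X) :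
    X.card = seqWt L.flatten := by
  induction L generalizing X with
  | nil =>
    rw [List.map_nil, Splits] at h
    subst h
    rfl
  | cons l L ih =>
    obtain ⟨Y, hY, h1, h2⟩ := h
    rw [List.flatten_cons, seqWt_append, ← ih h2, ← W.word_eq_iff.2 h1, W.seqWt_word,
      add_comm, Finset.card_sdiff_add_card_eq_card hY]

/-- If `X` is coloured so that the colour classes have words `ℓ 0, …, ℓ (k - 1)`, then the word
of `X` is at most as long as their product, and it is a shuffle of them in case of equality. -/
theorem shuffle_of_colouring {X : Finset Ω} {k : ℕ} {ℓ : ℕ → List B} {c : Ω → ℕ}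
    (hc : ∀ x ∈ X, c x < k) (hℓ : ∀ i < k, W.word (X.filter (c · = i)) = ℓ i) :
    (W.word X).length ≤ ∑ i ∈ Finset.range k, (ℓ i).length ∧
      ((W.word X).length = ∑ i ∈ Finset.range k, (ℓ i).length →
        ∃ z : List (B × ℕ), z.map Prod.fst = W.word X ∧ (∀ p ∈ z, p.2 < k) ∧
          ∀ i < k, (z.filter (·.2 = i)).map Prod.fst = ℓ i) := by
  obtain ⟨P, -, hX, hcard, hQ⟩ := W.decomp X
  have hPX : ∀ l, P l ⊆ X := fun l => by
    conv_rhs => rw [← hX]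
    exact Finset.subset_biUnion_of_mem P (Finset.mem_univ l)
  -- Each colour class meets each piece `P l` in a subset, so one index set of pieces decomposes the
  -- words of all the classes.
  choose S hS hSl using fun i => hQ (fun l => (P l).filter (c · = i)) fun l =>
    Finset.filter_subset _ _
  have hℓS : ∀ i < k, ℓ i = (List.ofFn (S i)).flatten := by
    intro i hi
    rw [← hℓ i hi, ← hS i]
    have : X.filter (c · = i) = Finset.univ.biUnion fun l => (P l).filter (c · = i) := by
      conv_lhs => rw [← hX]
      exact Finset.filter_biUnion _ _ _
    rw [← this]
  have hsum : ∑ i ∈ Finset.range k, (ℓ i).length =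
      ∑ l, ∑ i ∈ Finset.range k, (S i l).length := by
    rw [Finset.sum_comm]
    refine Finset.sum_congr rfl fun i hi => ?_
    rw [hℓS i (Finset.mem_range.1 hi), List.length_flatten, List.map_ofFn, List.sum_ofFn]
    rfl
  have hne : ∀ l, (P l).Nonempty := fun l => by
    rw [← Finset.card_pos, hcard]
    exact ConnectedBlocks.wt_pos _
  choose x hx using hne
  have hck : ∀ l, c (x l) < k := fun l => hc _ (hPX l (hx l))
  have hS0 : ∀ i l, S i l = [] → (P l).filter (c · = i) = ∅ := fun i l h => by
    rw [← Finset.card_eq_zero, ← (hSl i l).1, h]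
    rfl
  have hpos : ∀ l, 1 ≤ (S (c (x l)) l).length := fun l => by
    rw [Nat.one_le_iff_ne_zero, Ne, List.length_eq_zero_iff]
    intro h
    have : x l ∈ (P l).filter (c · = c (x l)) := Finset.mem_filter.2 ⟨hx l, rfl⟩
    rw [hS0 _ _ h] at this
    exact absurd this (Finset.notMem_empty _)
  -- Every piece is non-empty and so contributes at least one block to the class of some colour;
  -- summing over pieces gives the length bound.
  have hN : ∀ l, 1 ≤ ∑ i ∈ Finset.range k, (S i l).length := fun l =>
    (hpos l).trans (Finset.single_le_sum (f := fun i => (S i l).length)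
      (fun _ _ => Nat.zero_le _) (Finset.mem_range.2 (hck l)))
  have hm : (W.word X).length = ∑ _l : Fin (W.word X).length, 1 := by simp
  refine ⟨?_, fun heq => ?_⟩
  · rw [hsum]
    exact hm.le.trans (Finset.sum_le_sum fun l _ => hN l)
  rw [hsum] at heq
  replace heq := hm.symm.trans heq
  -- Equality of lengths forces exactly one block per piece, so each piece has a single colour, that
  -- of `x l`, and lies wholly in that class.
  have hN1 : ∀ l, ∑ i ∈ Finset.range k, (S i l).length = 1 := fun l =>
    ((Finset.sum_eq_sum_iff_of_le fun l _ => hN l).1 heq l (Finset.mem_univ l)).symm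
  have hnil : ∀ i < k, ∀ l, i ≠ c (x l) → S i l = [] := by
    intro i hi l hil
    have h1 := Finset.add_sum_erase (Finset.range k) (fun i => (S i l).length)
      (Finset.mem_range.2 (hck l))
    have h2 := Finset.single_le_sum (f := fun i => (S i l).length)
      (fun _ _ => Nat.zero_le _) (Finset.mem_erase.2 ⟨hil, Finset.mem_range.2 hi⟩)
    have h3 := hpos l
    have h4 := hN1 l
    rw [← List.length_eq_zero_iff]
    omega
  have hsingle : ∀ l, S (c (x l)) l = [(W.word X).get l] := by
    intro l
    refine (hSl (c (x l)) l).2 (Finset.filter_true_of_mem fun y hy => ?_)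
    by_contra hne
    have : y ∈ (P l).filter (c · = c y) := Finset.mem_filter.2 ⟨hy, rfl⟩
    rw [hS0 _ _ (hnil (c y) (hc y (hPX l hy)) l hne)] at this
    exact absurd this (Finset.notMem_empty _)
  refine ⟨List.ofFn fun l => ((W.word X).get l, c (x l)), ?_, ?_, ?_⟩
  · rw [List.map_ofFn]
    exact List.ofFn_get _
  · intro p hp
    obtain ⟨l, rfl⟩ := (List.mem_ofFn' _ _).1 hp
    exact hck l
  · intro i hi
    rw [map_filter_eq_flatten, List.map_ofFn, hℓS i hi]
    refine congrArg (fun f => (List.ofFn f).flatten) (funext fun l => ?_)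
    by_cases h : c (x l) = i
    · subst h
      simp only [Function.comp_apply, decide_true, if_true]
      exact (hsingle l).symm
    · simp [h, hnil i hi l (Ne.symm h)]

/-- Words are compared by length first and then lexicographically. -/
def lenLex {α : Type*} (w : List α) : ℕ ×ₗ List α := toLex (w.length, w)

theorem lenLex_injective {α : Type*} : Function.Injective (lenLex (α := α)) := fun _ _ h =>
  congrArg (fun p => (ofLex p).2) h

/-- The triangularity: the leading word of a product of Lyndon factors bounds the word of any set at
which the product does not vanish. -/
theorem lenLex_word_le {L : List (List B)} (hL : ∀ l ∈ L, IsLyndon l) (hs : L.Pairwise (· ≥ ·))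
    {X : Finset Ω} (h : Splits (L.map W.φ.symm) X) : lenLex (W.word X) ≤ lenLex L.flatten := by
  obtain ⟨c, hc, hcL⟩ := h.exists_colouring
  rw [List.length_map] at hc
  -- The default `[]` is never reached, as only indices below `L.length` occur.
  have hLr : (List.range L.length).map (fun i => L.getD i []) = L := by
    apply List.ext_getElem
    · simp
    · intro i h1 h2
      simp [h2]
  have hlen : L.flatten.length = ∑ i ∈ Finset.range L.length, (L.getD i []).length := by
    conv_lhs => rw [← hLr]
    rw [List.length_flatten, List.map_map]
    rfl
  obtain ⟨h1, h2⟩ := W.shuffle_of_colouring (k := L.length) (ℓ := fun i => L.getD i []) hc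
    fun i hi => by
      rw [W.word_eq_iff, hcL i (by simpa using hi)]
      simp [hi]
  rw [← hlen] at h1 h2
  rw [lenLex, lenLex, Prod.Lex.toLex_le_toLex]
  rcases h1.lt_or_eq with h1 | h1
  · exact Or.inl h1
  · refine Or.inr ⟨h1, ?_⟩
    obtain ⟨z, hz, hzk, hzf⟩ := h2 h1
    have := shuffle_le (k := L.length) (ℓ := fun i => L.getD i []) ?_ ?_ hzk hzf
    · rwa [hz, hLr] at this
    · intro i hi
      simpa [hi] using hL _ (List.getElem_mem hi)
    · intro i j hij hj
      have hi := hij.trans hj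
      simpa [hi, hj] using List.pairwise_iff_getElem.1 hs i j hi hj hij

end WreathALike

end Wreath

end PermAlg

namespace PermAlg

/-! ### Generation and algebraic independence -/

section Main

variable {K : Type*} [Field K] {G : Type*} [Group G] {Ω : Type*} [DecidableEq Ω] [MulAction G Ω]
  {B : Type*} [ConnectedBlocks B]

namespace WreathALike

variable (W : WreathALike G Ω B)

variable (K) in
/-- The characteristic function of the orbit with a given word. -/
noncomputable def chi (w : List B) : A K G Ω := charFn K (W.φ.symm w)

open Classical in
theorem ev_chi (X : Finset Ω) (w : List B) :
    ev K G X (W.chi K w) = if W.word X = w then 1 else 0 := by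
  rw [chi, ev_charFn]
  simp only [W.word_eq_iff]

theorem finite_words (W : WreathALike G Ω B) (hG : IsOligomorphic G Ω) (n : ℕ) :
    {w : List B | seqWt w = n}.Finite := by
  have := hG n
  let F : MulAction.orbitRel.Quotient G (Set.powersetCard Ω n) → SetOrbit G Ω :=
    Quotient.lift (fun X => orbitOf G X.1) (by
      rintro a b ⟨g, rfl⟩
      exact orbitOf_smul g b.1)
  refine ((Set.finite_range F).image W.φ).subset fun w hw => ?_
  obtain ⟨X, rfl⟩ := W.exists_word_eq w
  have hX : X.card = n := (W.seqWt_word X).symm.trans hw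
  exact ⟨orbitOf G X, ⟨Quotient.mk _ ⟨X, hX⟩, rfl⟩, rfl⟩

/-- An element supported on finitely many words is the combination of their `χ_w` whose coefficients
are its values on representatives. -/
theorem mem_of_forall_chi_mem (R : Submodule K (A K G Ω)) (T : Finset (List B))
    (hT : ∀ w ∈ T, W.chi K w ∈ R) {a : A K G Ω} (ha : ∀ X, W.word X ∉ T → ev K G X a = 0) :
    a ∈ R := by
  choose rep hrep using W.exists_word_eq
  have : a = ∑ w ∈ T, ev K G (rep w) a • W.chi K w := by
    refine ev_ext fun X => ?_
    simp only [map_sum, map_smul, ev_chi, smul_eq_mul, mul_ite, mul_one, mul_zero,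
      Finset.sum_ite_eq]
    split_ifs with h
    · exact ev_eq_of_orbitOf_eq (W.φ.injective (hrep (W.word X)).symm) a
    · exact ha X h
  rw [this]
  exact Submodule.sum_mem _ fun w hw => Submodule.smul_mem _ _ (hT w hw)

/-- Characteristic zero enters here: a positive number of splittings stays non-zero in `K`. -/
theorem ev_prod_chi_ne_zero [CharZero K] {L : List (List B)} {X : Finset Ω} :
    ev K G X (L.map (W.chi K)).prod ≠ 0 ↔ Splits (L.map W.φ.symm) X := by
  obtain ⟨n, hn, hs⟩ := exists_ev_prod_charFn (K := K) (L.map W.φ.symm) X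
  rw [List.map_map] at hn
  rw [← hs, ← Nat.cast_ne_zero (R := K), ← hn]
  rfl

/-- A subalgebra that contains the `χ_w` for the Lyndon words `w` contains all `χ_w`. -/
theorem chi_mem_of_lyndon [CharZero K] (hG : IsOligomorphic G Ω) (R : Subalgebra K (A K G Ω))
    (hR : ∀ l, IsLyndon l → W.chi K l ∈ R) (w : List B) : W.chi K w ∈ R := by
  classical
  by_contra hw
  -- A least counterexample exists because only finitely many words have the given weight.
  obtain ⟨w, hw, hmin⟩ := ((W.finite_words hG (seqWt w)).toFinset.filter
    (W.chi K · ∉ R)).exists_min_image lenLex ⟨w, by simpa using hw⟩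
  simp only [Finset.mem_filter, Set.Finite.mem_toFinset, Set.mem_ofPred_eq] at hw hmin
  obtain ⟨L, hL, hs, rfl⟩ := exists_lyndon_factorization w
  set p : A K G Ω := (L.map (W.chi K)).prod with hp
  have hpR : p ∈ R := by
    refine Subalgebra.list_prod_mem R fun a ha => ?_
    obtain ⟨l, hl, rfl⟩ := List.mem_map.1 ha
    exact hR l (hL l hl)
  obtain ⟨X₀, hX₀⟩ := W.exists_word_eq L.flatten
  set c : K := ev K G X₀ p with hc
  have hc0 : c ≠ 0 := W.ev_prod_chi_ne_zero.2 (W.splits_of_word_eq_flatten hX₀)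
  -- The coefficient `c` cancels the leading word of `p`; what remains is supported on smaller words
  -- of the same weight, whose `χ` lie in `R` by minimality.
  have hdiff : c • W.chi K L.flatten + (-1 : K) • p ∈ Subalgebra.toSubmodule R := by
    refine W.mem_of_forall_chi_mem _ ((W.finite_words hG (seqWt L.flatten)).toFinset.filter
      (lenLex · < lenLex L.flatten)) ?_ ?_
    · intro v hv
      simp only [Finset.mem_filter, Set.Finite.mem_toFinset, Set.mem_ofPred_eq] at hv
      by_contra hvR
      exact absurd hv.2 (not_lt.2 (hmin v ⟨hv.1.trans hw.1, hvR⟩))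
    · intro X hX
      rw [map_add, map_smul, map_smul, ev_chi, smul_eq_mul, smul_eq_mul]
      by_cases hXw : W.word X = L.flatten
      · rw [if_pos hXw, mul_one, hc, neg_one_mul, add_neg_eq_zero]
        exact (ev_eq_of_orbitOf_eq (W.φ.injective (hXw.trans hX₀.symm)) p).symm
      · rw [if_neg hXw, mul_zero, zero_add]
        by_contra hne
        have hsp := W.ev_prod_chi_ne_zero.1 (right_ne_zero_of_mul hne)
        refine hX ?_
        simp only [Finset.mem_filter, Set.Finite.mem_toFinset, Set.mem_ofPred_eq]
        exact ⟨(W.seqWt_word X).trans (W.card_of_splits hsp),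
          lt_of_le_of_ne (W.lenLex_word_le hL hs hsp) fun h => hXw (lenLex_injective h)⟩
  have hchi : W.chi K L.flatten =
      c⁻¹ • ((c • W.chi K L.flatten + (-1 : K) • p) + p) := by
    refine ev_ext fun X => ?_
    simp only [map_add, map_smul, smul_eq_mul]
    field_simp
    ring
  rw [hchi] at hw
  exact hw.2 (R.smul_mem (R.add_mem hdiff hpR) c⁻¹)

theorem eq_top_of_lyndon [CharZero K] (hG : IsOligomorphic G Ω) (R : Subalgebra K (A K G Ω))
    (hR : ∀ l, IsLyndon l → W.chi K l ∈ R) : R = ⊤ := by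
  rw [eq_top_iff]
  rintro a -
  induction a using DirectSum.induction_on with
  | zero => exact R.zero_mem
  | add a b ha hb => exact R.add_mem ha hb
  | of n f =>
    refine W.mem_of_forall_chi_mem (Subalgebra.toSubmodule R) (W.finite_words hG n).toFinset
      (fun w _ => W.chi_mem_of_lyndon hG R hR w) fun X hX => ?_
    rw [Set.Finite.mem_toFinset, Set.mem_ofPred_eq, W.seqWt_word] at hX
    rw [ev_of, ext0_of_card_ne f hX]

end WreathALike

/-- The non-increasing sequence of Lyndon words in a monomial. -/
noncomputable def factors (m : {w : List B // IsLyndon w} →₀ ℕ) : List (List B) :=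
  ((Finsupp.toMultiset m).sort (· ≥ ·)).map Subtype.val

theorem factors_isLyndon (m : {w : List B // IsLyndon w} →₀ ℕ) : ∀ l ∈ factors m, IsLyndon l := by
  intro l hl
  obtain ⟨l, -, rfl⟩ := List.mem_map.1 hl
  exact l.2

theorem factors_pairwise (m : {w : List B // IsLyndon w} →₀ ℕ) :
    (factors m).Pairwise (· ≥ ·) :=
  List.pairwise_map.2 (Multiset.pairwise_sort _ _)

/-- Distinct monomials have distinct leading words, by uniqueness of the Lyndon factorisation. -/
theorem flatten_factors_injective :
    Function.Injective fun m : {w : List B // IsLyndon w} →₀ ℕ => (factors m).flatten := by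
  intro m m' h
  have h1 : factors m = factors m' := lyndon_factorization_unique (factors_isLyndon m)
    (factors_isLyndon m') (factors_pairwise m) (factors_pairwise m') h
  have h2 := List.map_injective_iff.2 Subtype.val_injective h1
  have h3 := congrArg (fun l : List {w : List B // IsLyndon w} =>
    (l : Multiset {w : List B // IsLyndon w})) h2
  simp only [Multiset.sort_eq] at h3
  exact Multiset.toFinsupp.symm.injective h3

theorem prod_factors {R : Type*} [CommMonoid R] (f : List B → R)
    (m : {w : List B // IsLyndon w} →₀ ℕ) :
    (m.prod fun w k => f w.1 ^ k) = ((factors m).map f).prod := by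
  rw [factors, List.map_map, ← Multiset.prod_coe, ← Multiset.map_coe, Multiset.sort_eq,
    Finsupp.toMultiset_map, Finsupp.prod_toMultiset,
    Finsupp.prod_mapDomain_index (fun _ => pow_zero _) (fun _ _ _ => pow_add _ _ _)]
  rfl

namespace WreathALike

variable (W : WreathALike G Ω B)

theorem ev_aeval (X : Finset Ω) (p : MvPolynomial {w : List B // IsLyndon w} K) :
    ev K G X (MvPolynomial.aeval (fun w : {w : List B // IsLyndon w} => W.chi K w.1) p) =
      ∑ m ∈ p.support, p.coeff m * ev K G X ((factors m).map (W.chi K)).prod := by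
  conv_lhs => rw [← p.support_sum_monomial_coeff, map_sum]
  refine (map_sum (ev K G X) _ _).trans (Finset.sum_congr rfl fun m _ => ?_)
  rw [MvPolynomial.aeval_monomial, ← Algebra.smul_def, prod_factors (W.chi K) m]
  exact (ev K G X).map_smul _ _

theorem aeval_chi_injective [CharZero K] : Function.Injective
    (MvPolynomial.aeval (R := K) fun w : {w : List B // IsLyndon w} => W.chi K w.1) := by
  rw [injective_iff_map_eq_zero]
  intro p hp
  by_contra hp0
  -- At a set with the greatest leading word only this monomial can be non-zero: another one there
  -- would have a leading word at least as great, hence equal.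
  obtain ⟨m, hm, hmax⟩ := p.support.exists_max_image (fun m => lenLex (factors m).flatten)
    (MvPolynomial.support_nonempty.2 hp0)
  obtain ⟨X, hX⟩ := W.exists_word_eq (factors m).flatten
  have h := W.ev_aeval X p
  rw [hp, Finset.sum_eq_single_of_mem m hm] at h
  · exact mul_ne_zero (MvPolynomial.mem_support_iff.1 hm)
      (W.ev_prod_chi_ne_zero.2 (W.splits_of_word_eq_flatten hX)) (h.symm.trans (ev K G X).map_zero)
  · intro m' hm' hne
    by_contra h0
    have h1 := W.ev_prod_chi_ne_zero.1 (right_ne_zero_of_mul h0)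
    have h2 := W.lenLex_word_le (factors_isLyndon m') (factors_pairwise m') h1
    rw [hX] at h2
    exact hne (flatten_factors_injective (lenLex_injective ((hmax m' hm').antisymm h2)))

theorem aeval_chi_surjective [CharZero K] (hG : IsOligomorphic G Ω) : Function.Surjective
    (MvPolynomial.aeval (R := K) fun w : {w : List B // IsLyndon w} => W.chi K w.1) := by
  rw [← AlgHom.range_eq_top]
  exact W.eq_top_of_lyndon hG _ fun l hl => ⟨MvPolynomial.X ⟨l, hl⟩, MvPolynomial.aeval_X _ _⟩

end WreathALike

end Main

end PermAlg

theorem mainTheorem1 {K : Type*} [Field K] [CharZero K] {Ω : Type*} [DecidableEq Ω]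
    (G : Subgroup (Equiv.Perm Ω)) (hG : PermAlg.IsOligomorphic G Ω)
    {B : Type*} [PermAlg.ConnectedBlocks B] (W : PermAlg.WreathALike G Ω B) :
    ∃ e : MvPolynomial {w : List B // PermAlg.IsLyndon w} K ≃ₐ[K] PermAlg.A K G Ω,
      ∀ w : {w : List B // PermAlg.IsLyndon w},
        e (MvPolynomial.X w) = PermAlg.charFn K (W.φ.symm w.1) :=
  ⟨AlgEquiv.ofBijective _ ⟨W.aeval_chi_injective, W.aeval_chi_surjective hG⟩, fun w =>
    MvPolynomial.aeval_X (fun w : {w : List B // PermAlg.IsLyndon w} => W.chi K w.1) w⟩
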